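/- For each sample size $n$ let $d=d_n$ with $d_n\ge 2$ for all large $n$, and consider a two-class model with class label $L\in\{1,2\}$, $\pi_i=P(L=i)$, and binary vectors ${\bf U},{\bf V}\in\{0,1\}^d$ with mass functions $p_1,p_2$, where $L,{\bf U},{\bf V}$ are independent. Put ${\bf W}={\bf U}I\{L=1\}+{\bf V}I\{L=2\}$ and ${\bf H}={\rm Var}({\bf W})$. Assume the main effects model $$\eta({\bf u})=\log\frac{\pi_1p_1({\bf u})}{\pi_2p_2({\bf u})}=A_0+{\bf A}^T{\bf u}$$ (that is, $\pi_1p_1({\bf u})=e^{A_0+{\bf A}^T{\bf u}}\,\pi_2p_2({\bf u})$ for all ${\bf u}\in\{0,1\}^d$), where all quantities may depend on $n$. Let ${\cal M}=\{j:A_j\ne0\}$ and $M=|{\cal M}|$, with $M\ge1$ for all large $n$, and assume that there is a constant $B$ with $\sup_{{\bf u}\in\{0,1\}^d}|A_0+{\bf A}^T{\bf u}|\le M+B$ for all $n$ (for instance, $|A_0|\le B$ and $|A_j|\le1$ for all $j$). Assume further: (C5) ${\bf H}$ is positive definite, with eigenvalues at least $c$, for a constant $c>0$ that does not depend on $n$;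 (C6) $1-\max_{e\in{\cal M}^c}|{\bf H}_{e,{\cal M}}{\bf H}_{{\cal M},{\cal M}}^{-1}|_1>0$, where $|\cdot|_1$ is the $\ell_1$ norm of the row vector (no condition if ${\cal M}^c=\emptyset$), and $M^2e^M\sqrt{\log d/n}\to0$ as $n\to\infty$. Let $(L_1,{\bf W}_1),\dots,(L_n,{\bf W}_n)$ be i.i.d. copies of $(L,{\bf W})$, and let $(\hat A_0,\hat{\bf A})$ be a minimizer, over $a_0\in\mathbb R$ and ${\bf a}\in\mathbb R^d$, of $$\frac1n\Big\{\sum_{i:L_i=1}\big[-(a_0+{\bf a}^T{\bf W}_i)+\log(1+e^{a_0+{\bf a}^T{\bf W}_i})\big]+\sum_{i:L_i=2}\log(1+e^{a_0+{\bf a}^T{\bf W}_i})\Big\}+\lambda_\eta|{\bf a}|_1$$ (any minimizer if there are several, and arbitrary on samples for which there is none). Let $\hat\eta({\bf u})=\hat A_0+\hat{\bf A}^T{\bf u}$. Then there is a universal constant $C_0>0$ such that, whenever $C_0\sqrt{\log d/n}\le\lambda_\eta\le C_1\sqrt{\log d/n}$ for all large $n$, with some constant $C_1$, $$\sup_{{\bf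 u}\in\{0,1\}^d}|\hat\eta({\bf u})-\eta({\bf u})|=O_p\Big(M^2e^M\sqrt{\tfrac{\log d}{n}}\Big),$$ where $\eta({\bf u})$ stands for $A_0+{\bf A}^T{\bf u}$, and $X_n=O_p(r_n)$ means that for every $\varepsilon>0$ there is a $K$ with $P(|X_n|>Kr_n)\le\varepsilon$ for all large $n$. -/

import Mathlib

open MeasureTheory ProbabilityTheory Filter Topology

noncomputable section

/-- The cells `{0,1}^d`; `true` stands for `1`. -/
abbrev Cube (d : ℕ) : Type := Fin d → Bool

/-- A binary coordinate as a real number. -/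
def bit (b : Bool) : ℝ := if b then 1 else 0

/-- The discrete part of the two-class model. The label `true` is class 1 and `false` is class 2;
`prior` is the law of the label, and `p₁`, `p₂` are the probability mass functions of the
binary vector in the two classes. -/
structure DiscreteModel (d : ℕ) where
  prior : PMF Bool
  p₁ : PMF (Cube d)
  p₂ : PMF (Cube d)

namespace DiscreteModel

variable {d : ℕ}

/-- The joint law of `(L, U, V)`: independent, `U` with mass function `p₁`, `V` with `p₂`. -/
def population (P : DiscreteModel d) : Measure (Bool × Cube d × Cube d) :=
  P.prior.toMeasure.prod (P.p₁.toMeasure.prod P.p₂.toMeasure)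

/-- `W = U I{L = 1} + V I{L = 2}`. -/
def mixture (x : Bool × Cube d × Cube d) : Cube d := if x.1 then x.2.1 else x.2.2

/-- The law of one observation `(L, W)`. -/
def obsLaw (P : DiscreteModel d) : Measure (Bool × Cube d) :=
  P.population.map (fun x => (x.1, mixture x))

/-- The covariance matrix `H = Var(W)`. -/
def covMatrix (P : DiscreteModel d) : Matrix (Fin d) (Fin d) ℝ :=
  Matrix.of fun i j =>
    cov[fun x => bit (mixture x i), fun x => bit (mixture x j); P.population]

end DiscreteModel

/-- The linear function `A₀ + Aᵀ u` of `u ∈ {0,1}^d`. -/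
def linPred {d : ℕ} (A₀ : ℝ) (A : Fin d → ℝ) (u : Cube d) : ℝ := A₀ + ∑ i, A i * bit (u i)

/-- The main effects model `log (π₁ p₁(u) / (π₂ p₂(u))) = A₀ + Aᵀ u`, written multiplicatively, so
that it says nothing about a cell that neither class visits. -/
def DiscreteModel.MainEffects {d : ℕ} (P : DiscreteModel d) (A₀ : ℝ) (A : Fin d → ℝ) : Prop :=
  ∀ u : Cube d, (P.prior true).toReal * (P.p₁ u).toReal =
    Real.exp (linPred A₀ A u) * ((P.prior false).toReal * (P.p₂ u).toReal)

/-- When all cells have positive probability, the multiplicative form is the log-odds form. -/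
theorem DiscreteModel.mainEffects_iff_log {d : ℕ} (P : DiscreteModel d) (A₀ : ℝ)
    (A : Fin d → ℝ) (hπ₁ : P.prior true ≠ 0) (hπ₂ : P.prior false ≠ 0)
    (h₁ : ∀ u, P.p₁ u ≠ 0) (h₂ : ∀ u, P.p₂ u ≠ 0) :
    P.MainEffects A₀ A ↔ ∀ u : Cube d,
      Real.log (((P.prior true).toReal * (P.p₁ u).toReal) /
        ((P.prior false).toReal * (P.p₂ u).toReal)) = linPred A₀ A u := by
  refine forall_congr' fun u => ?_
  have a := ENNReal.toReal_pos hπ₁ (P.prior.apply_ne_top _)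
  have b := ENNReal.toReal_pos hπ₂ (P.prior.apply_ne_top _)
  have c := ENNReal.toReal_pos (h₁ u) (P.p₁.apply_ne_top _)
  have e := ENNReal.toReal_pos (h₂ u) (P.p₂.apply_ne_top _)
  rw [← div_eq_iff (mul_pos b e).ne']
  constructor
  · intro h
    rw [h, Real.log_exp]
  · intro h
    rw [← h, Real.exp_log (div_pos (mul_pos a c) (mul_pos b e))]

open Classical in
/-- The support `{j : A_j ≠ 0}`. -/
def coefSupport {d : ℕ} (A : Fin d → ℝ) : Finset (Fin d) := Finset.univ.filter fun j => A j ≠ 0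

/-- The row vector `H_{e,S} H_{S,S}⁻¹`. -/
def irrepRow {d : ℕ} (H : Matrix (Fin d) (Fin d) ℝ) (S : Finset (Fin d)) (e : Fin d) :
    {j // j ∈ S} → ℝ :=
  Matrix.vecMul (fun j : {j // j ∈ S} => H e j)
    (H.submatrix (Subtype.val : {j // j ∈ S} → Fin d) Subtype.val)⁻¹

/-- Irrepresentability: `1 - max_{e ∉ S} |H_{e,S} H_{S,S}⁻¹|₁ > 0`. -/
def Irrepresentable {d : ℕ} (H : Matrix (Fin d) (Fin d) ℝ) (S : Finset (Fin d)) : Prop :=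
  ∀ e, e ∉ S → ∑ j, |irrepRow H S e j| < 1

/-- The `ℓ₁`-penalized logistic loss of the coefficients `θ = (A₀, A)` on the labelled
sample `s`. -/
def penLogisticLoss {n d : ℕ} (lam : ℝ) (s : Fin n → Bool × Cube d)
    (θ : ℝ × (Fin d → ℝ)) : ℝ :=
  (1 / (n : ℝ)) *
    ((∑ i with (s i).1 = true,
        (-(linPred θ.1 θ.2 (s i).2) + Real.log (1 + Real.exp (linPred θ.1 θ.2 (s i).2)))) +
      ∑ i with (s i).1 = false, Real.log (1 + Real.exp (linPred θ.1 θ.2 (s i).2))) +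
    lam * ∑ j, |θ.2 j|

/-- `θ` is a global minimizer of the `ℓ₁`-penalized logistic loss. -/
def IsPenLogisticMin {n d : ℕ} (lam : ℝ) (s : Fin n → Bool × Cube d)
    (θ : ℝ × (Fin d → ℝ)) : Prop :=
  ∀ θ', penLogisticLoss lam s θ ≤ penLogisticLoss lam s θ'

/-- `X n = O_p(r n)` as `n → ∞`. -/
def IsBigOP {Ω : ℕ → Type*} [∀ n, MeasurableSpace (Ω n)] (μ : ∀ n, Measure (Ω n))
    (X : ∀ n, Ω n → ℝ) (r : ℕ → ℝ) : Prop :=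
  ∀ ε : ℝ, 0 < ε → ∃ K : ℝ, ∀ᶠ n in atTop,
    μ n {ω | K * r n < |X n ω|} ≤ ENNReal.ofReal ε

/-- The rate `M² e^M √(log d / n)`. -/
def etaRate (M d n : ℕ) : ℝ :=
  (M : ℝ) ^ 2 * Real.exp (M : ℝ) * Real.sqrt (Real.log (d : ℝ) / (n : ℝ))

end

/-! The proof localizes a convex function. Write a perturbation of the true coefficients in the
features `1, u_j - E W_j`. Its `ℓ₁` norm `N` in these coordinates dominates its supremum over the
cube, so it suffices to show that on the sphere `N = r`, with `r = K · etaRate`, the penalized loss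
exceeds its value at the truth. By convexity a minimizer then exists and every minimizer lies inside
the sphere (`ConvexOn.exists_min_and_lt_of_sphere`).

As `r ≤ 1` eventually, all predictors involved are bounded by `R = M + B + 1`, where the logistic
loss has curvature at least `e^{-R}/4` (`softplus_add_ge`); this produces the factor `e^M`. The
score has mean zero and, by Hoeffding, sup norm at most `τ` of order `√(log d / n)`. If the loss did
not increase, the perturbation would lie in the lasso cone, where `N²` is at most a constant times
`M` times the population second moment of the predictor. Centering makes the Gram matrix block
diagonal with blocks `1` and `H`, so the eigenvalue bound applies directly. Replacing the population
Gram matrix by the empirical one costs `O(√(log d / n)) N²`, which is absorbed. Hence `r` would be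
`O(M e^M √(log d / n))`, a contradiction for large `K`.

A universal `C₀` needs one more idea. The cone requires `τ ≤ λ/2`, so `τ = 4 √(log d / n)`, whose
failure probability is small only for large `d`. When `d ≤ 4/ε` no cone is needed: Cauchy–Schwarz
over all coordinates suffices, and `τ` may use a constant depending on `ε`. -/

/-! ### Curvature of the logistic loss. -/

/-- The logistic log-partition function `log (1 + eˣ)`. -/
noncomputable def softplus (x : ℝ) : ℝ := Real.log (1 + Real.exp x)

theorem hasDerivAt_softplus (x : ℝ) : HasDerivAt softplus (Real.sigmoid x) x := by
  have h : HasDerivAt (fun x => 1 + Real.exp x) (Real.exp x) x :=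
    (Real.hasDerivAt_exp x).const_add 1
  have hpos : (1 + Real.exp x) ≠ 0 := by positivity
  convert h.log hpos using 1
  · rfl
  rw [Real.sigmoid_def, Real.exp_neg]
  have := Real.exp_pos x
  field_simp
  ring

theorem continuous_softplus : Continuous softplus :=
  continuous_iff_continuousAt.2 fun x => (hasDerivAt_softplus x).continuousAt

theorem convexOn_softplus : ConvexOn ℝ Set.univ softplus := by
  refine MonotoneOn.convexOn_of_deriv convex_univ continuous_softplus.continuousOn
    (fun x _ => (hasDerivAt_softplus x).differentiableAt.differentiableWithinAt) ?_
  have : deriv softplus = Real.sigmoid := funext fun x => (hasDerivAt_softplus x).deriv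
  rw [this]
  exact Real.sigmoid_monotone.monotoneOn _

theorem ConvexOn.add_deriv_mul_le {S : Set ℝ} {f : ℝ → ℝ} {f' x y : ℝ} (hf : ConvexOn ℝ S f)
    (hx : x ∈ S) (hy : y ∈ S) (h : HasDerivAt f f' x) : f x + f' * (y - x) ≤ f y := by
  rcases lt_trichotomy x y with hxy | rfl | hxy
  · have := hf.le_slope_of_hasDerivAt hx hy hxy h
    rw [slope_def_field, le_div_iff₀ (sub_pos.2 hxy)] at this
    linarith
  · simp
  · have := hf.slope_le_of_hasDerivAt hy hx hxy h
    rw [slope_def_field, div_le_iff₀ (sub_pos.2 hxy)] at this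
    linarith

/-- The left factor is at least `1/2` for `x ≥ 0`, and `1 - σ(x) = σ(x) e^{-x}`; both sides are even
in `x`. -/
theorem exp_neg_abs_le_sigmoid_mul (x : ℝ) :
    Real.exp (-|x|) / 4 ≤ Real.sigmoid x * (1 - Real.sigmoid x) := by
  wlog hx : 0 ≤ x generalizing x
  · have := this (-x) (by linarith)
    rw [abs_neg, Real.sigmoid_neg] at this
    linarith
  rw [abs_of_nonneg hx, ← Real.sigmoid_neg, ← Real.sigmoid_mul_rexp_neg]
  have h : (1 : ℝ) / 2 ≤ Real.sigmoid x := by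
    have := Real.sigmoid_monotone hx
    rw [Real.sigmoid_zero] at this
    linarith
  have := Real.exp_pos (-x)
  nlinarith [mul_self_nonneg (Real.sigmoid x - 1 / 2)]

/-- A second-order lower bound for the logistic log-partition function on `[-R, R]`. -/
theorem softplus_add_ge {R x f : ℝ} (hx : |x| ≤ R) (hf : |x + f| ≤ R) :
    softplus x + Real.sigmoid x * f + Real.exp (-R) / 8 * f ^ 2 ≤ softplus (x + f) := by
  set m := Real.exp (-R) / 4 with hm
  have hd : ∀ t, HasDerivAt (fun t => softplus t - m / 2 * t ^ 2) (Real.sigmoid t - m * t) t := by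
    intro t
    refine ((hasDerivAt_softplus t).sub ((hasDerivAt_pow 2 t).const_mul (m / 2))).congr_deriv ?_
    push_cast
    ring
  have hd2 : ∀ t, HasDerivAt (fun t => Real.sigmoid t - m * t)
      (Real.sigmoid t * (1 - Real.sigmoid t) - m) t := by
    intro t
    exact ((Real.hasDerivAt_sigmoid t).sub ((hasDerivAt_id t).const_mul m)).congr_deriv
      (by rw [mul_one])
  have hmono : MonotoneOn (fun t => Real.sigmoid t - m * t) (Set.Icc (-R) R) := by
    refine monotoneOn_of_deriv_nonneg (convex_Icc _ _)
      (fun t _ => (hd2 t).continuousAt.continuousWithinAt)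
      (fun t _ => (hd2 t).differentiableAt.differentiableWithinAt) fun t ht => ?_
    rw [(hd2 t).deriv]
    rw [interior_Icc] at ht
    have h1 : |t| ≤ R := abs_le.2 ⟨ht.1.le, ht.2.le⟩
    have h2 : Real.exp (-R) ≤ Real.exp (-|t|) := Real.exp_le_exp.2 (by linarith)
    have := exp_neg_abs_le_sigmoid_mul t
    linarith
  -- Strong convexity as convexity after subtracting a parabola; the claim is then the tangent-line
  -- inequality.
  have hconv : ConvexOn ℝ (Set.Icc (-R) R) (fun t => softplus t - m / 2 * t ^ 2) := by
    refine MonotoneOn.convexOn_of_deriv (convex_Icc _ _)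
      (fun t _ => (hd t).continuousAt.continuousWithinAt)
      (fun t _ => (hd t).differentiableAt.differentiableWithinAt) ?_
    have : deriv (fun t => softplus t - m / 2 * t ^ 2) = fun t => Real.sigmoid t - m * t :=
      funext fun t => (hd t).deriv
    rw [this]
    exact hmono.mono interior_subset
  have := hconv.add_deriv_mul_le (abs_le.1 hx) (abs_le.1 hf) (hd x)
  simp only [hm] at this
  linarith

/-! ### Eigenvalue bound and concentration. -/

theorem Matrix.IsHermitian.mul_sum_sq_le_of_spectrum {ι : Type*} [Fintype ι] [DecidableEq ι]
    {H : Matrix ι ι ℝ} (hH : H.IsHermitian) {c : ℝ} (hc : ∀ x ∈ spectrum ℝ H, c ≤ x)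
    (v : ι → ℝ) : c * ∑ i, v i ^ 2 ≤ ∑ i, ∑ j, v i * v j * H i j := by
  have hps : (H - algebraMap ℝ (Matrix ι ι ℝ) c).PosSemidef := by
    rw [Matrix.posSemidef_iff_isHermitian_and_spectrum_nonneg]
    refine ⟨hH.sub ?_, ?_⟩
    · rw [Matrix.algebraMap_eq_diagonal]
      exact Matrix.isHermitian_diagonal _
    · rw [← spectrum.sub_singleton_eq]
      rintro _ ⟨x, hx, _, rfl, rfl⟩
      simpa using hc x hx
  have h := hps.dotProduct_mulVec_nonneg v
  rw [Matrix.sub_mulVec, dotProduct_sub, Matrix.algebraMap_eq_diagonal] at h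
  simp only [dotProduct, Matrix.mulVec, Matrix.diagonal_apply, star_trivial, Pi.algebraMap_apply,
    Algebra.algebraMap_self, RingHom.id_apply, ite_mul, zero_mul, Finset.sum_ite_eq,
    Finset.mem_univ, if_true, Finset.mul_sum] at h ⊢
  have e1 : ∑ i, v i * (c * v i) = ∑ i, c * v i ^ 2 := Finset.sum_congr rfl fun i _ => by ring
  have e2 : ∑ i, ∑ j, v i * (H i j * v j) = ∑ i, ∑ j, v i * v j * H i j :=
    Finset.sum_congr rfl fun i _ => Finset.sum_congr rfl fun j _ => by ring
  linarith

/-- **Hoeffding's inequality** for the empirical means of finitely many bounded functions. -/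
theorem measure_exists_empirical_dev_le {Ω S κ : Type*} [MeasurableSpace Ω] [MeasurableSpace S]
    [Fintype κ] {μ : Measure Ω} [IsProbabilityMeasure μ] {ν : Measure S} {n : ℕ} (hn : 0 < n)
    {X : Fin n → Ω → S} (hind : iIndepFun X μ) (hlaw : ∀ i, HasLaw (X i) ν μ) {h : κ → S → ℝ}
    (hm : ∀ k, Measurable (h k)) (hb : ∀ k x, |h k x| ≤ 1) {t : ℝ} (ht : 0 ≤ t) :
    μ {ω | ∃ k, t < |(∑ i, h k (X i ω)) / n - ∫ x, h k x ∂ν|} ≤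
      ENNReal.ofReal (2 * Fintype.card κ * Real.exp (-(n * t ^ 2 / 2))) := by
  have hn' : (0 : ℝ) < n := by exact_mod_cast hn
  have key : ∀ g : S → ℝ, Measurable g → (∀ x, |g x| ≤ 1) →
      μ {ω | t < (∑ i, g (X i ω)) / n - ∫ x, g x ∂ν} ≤
        ENNReal.ofReal (Real.exp (-(n * t ^ 2 / 2))) := by
    intro g hg hgb
    have hsub : ∀ i ∈ Finset.univ, HasSubgaussianMGF (fun ω => g (X i ω) - ∫ x, g x ∂ν) 1 μ := by
      intro i _
      have h1 := hasSubgaussianMGF_of_mem_Icc (μ := μ) (X := fun ω => g (X i ω)) (a := -1) (b := 1)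
        (hg.comp_aemeasurable (hlaw i).aemeasurable) (ae_of_all _ fun ω => abs_le.1 (hgb _))
      have h2 : ∫ ω, g (X i ω) ∂μ = ∫ x, g x ∂ν :=
        (hlaw i).integral_comp hg.aestronglyMeasurable
      rw [h2] at h1
      -- The range `[-1, 1]` gives the variance proxy `((1 - (-1)) / 2)² = 1`.
      convert h1 using 1
      ext
      norm_num
    have hind' : iIndepFun (fun i ω => g (X i ω) - ∫ x, g x ∂ν) μ :=
      hind.comp (fun _ x => g x - ∫ x, g x ∂ν) fun _ => hg.sub_const _
    have := HasSubgaussianMGF.measure_sum_ge_le_of_iIndepFun hind' hsub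
      (ε := n * t) (by positivity)
    rw [measureReal_def, ← ENNReal.le_ofReal_iff_toReal_le (measure_ne_top _ _)
      (Real.exp_pos _).le] at this
    refine (measure_mono ?_).trans (this.trans (ENNReal.ofReal_le_ofReal (le_of_eq ?_)))
    · intro ω hω
      simp only [Set.mem_ofPred_eq, Finset.sum_sub_distrib, Finset.sum_const, Finset.card_univ,
        Fintype.card_fin, nsmul_eq_mul] at hω ⊢
      have : t + ∫ x, g x ∂ν < (∑ i, g (X i ω)) / n := by linarith
      rw [lt_div_iff₀ hn'] at this
      linarith
    · have : ((∑ _i : Fin n, (1 : NNReal) : NNReal) : ℝ) = n := by simp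
      rw [this]
      congr 1
      field_simp
  have hsplit : {ω | ∃ k, t < |(∑ i, h k (X i ω)) / n - ∫ x, h k x ∂ν|} ⊆
      ⋃ k, ({ω | t < (∑ i, h k (X i ω)) / n - ∫ x, h k x ∂ν} ∪
        {ω | t < (∑ i, -h k (X i ω)) / n - ∫ x, -h k x ∂ν}) := by
    rintro ω ⟨k, hk⟩
    refine Set.mem_iUnion.2 ⟨k, ?_⟩
    rcases lt_abs.1 hk with h1 | h1
    · exact Or.inl h1
    · right
      simp only [Set.mem_ofPred_eq, Finset.sum_neg_distrib, integral_neg]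
      linarith [neg_div (n : ℝ) (∑ i, h k (X i ω))]
  refine (measure_mono hsplit).trans ((measure_iUnion_fintype_le _ _).trans ?_)
  refine (Finset.sum_le_sum fun k _ => (measure_union_le _ _).trans (add_le_add
    (key _ (hm k) (hb k)) (key _ (hm k).neg fun x => by simpa using hb k x))).trans ?_
  rw [← ENNReal.ofReal_add (Real.exp_pos _).le (Real.exp_pos _).le, Finset.sum_const,
    nsmul_eq_mul, Finset.card_univ, ← ENNReal.ofReal_natCast,
    ← ENNReal.ofReal_mul (Nat.cast_nonneg _)]
  exact ENNReal.ofReal_le_ofReal (le_of_eq (by ring))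

/-! ### Centered coordinates for linear predictors. -/

/-- The features `1, u₁ - m₁, …, u_d - m_d`. -/
def centeredFeature {d : ℕ} (m : Fin d → ℝ) : Option (Fin d) → Cube d → ℝ
  | none, _ => 1
  | some j, u => bit (u j) - m j

/-- The coefficients of a linear predictor with respect to the features `centeredFeature m`. -/
def centeredCoef {d : ℕ} (m : Fin d → ℝ) (θ : ℝ × (Fin d → ℝ)) : Option (Fin d) → ℝ
  | none => θ.1 + ∑ j, m j * θ.2 j
  | some j => θ.2 j

section CenteredFeature

variable {d : ℕ} {m : Fin d → ℝ}

theorem linPred_eq_sum_centered (m : Fin d → ℝ) (θ : ℝ × (Fin d → ℝ)) (u : Cube d) :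
    linPred θ.1 θ.2 u = ∑ k, centeredCoef m θ k * centeredFeature m k u := by
  simp only [Fintype.sum_option, centeredCoef, centeredFeature, linPred, mul_sub, mul_one,
    Finset.sum_sub_distrib]
  have : ∑ j, m j * θ.2 j = ∑ j, θ.2 j * m j := Finset.sum_congr rfl fun j _ => mul_comm _ _
  rw [this]
  ring

theorem bit_mem_Icc (b : Bool) : bit b ∈ Set.Icc (0 : ℝ) 1 := by
  cases b <;> simp [bit]

theorem abs_centeredFeature_le (hm : ∀ j, m j ∈ Set.Icc (0 : ℝ) 1) (k : Option (Fin d))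
    (u : Cube d) : |centeredFeature m k u| ≤ 1 := by
  cases k with
  | none => simp [centeredFeature]
  | some j =>
    have h1 := bit_mem_Icc (u j)
    have h2 := hm j
    simp only [centeredFeature]
    exact abs_le.2 ⟨by linarith [h1.1, h2.2], by linarith [h1.2, h2.1]⟩

/-- The features are bounded by `1`. This turns an `ℓ₁` bound on the coefficients into the uniform
bound over the cube, and also keeps perturbations within the range of the curvature bound. -/
theorem abs_linPred_le_sum_abs_centeredCoef (hm : ∀ j, m j ∈ Set.Icc (0 : ℝ) 1)
    (θ : ℝ × (Fin d → ℝ)) (u : Cube d) :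
    |linPred θ.1 θ.2 u| ≤ ∑ k, |centeredCoef m θ k| := by
  rw [linPred_eq_sum_centered m]
  refine (Finset.abs_sum_le_sum_abs _ _).trans (Finset.sum_le_sum fun k _ => ?_)
  rw [abs_mul]
  exact mul_le_of_le_one_right (abs_nonneg _) (abs_centeredFeature_le hm k u)

end CenteredFeature

/-! ### Population moments of the model. -/

namespace DiscreteModel

variable {d : ℕ} (P : DiscreteModel d)

theorem measurable_label_mixture :
    Measurable fun x : Bool × Cube d × Cube d => (x.1, mixture x) :=
  measurable_of_finite _

instance : IsProbabilityMeasure P.population := by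
  unfold population
  infer_instance

instance : IsProbabilityMeasure P.obsLaw :=
  Measure.isProbabilityMeasure_map measurable_label_mixture.aemeasurable

theorem obsLaw_real_true (u : Cube d) :
    P.obsLaw.real {(true, u)} = (P.prior true).toReal * (P.p₁ u).toReal := by
  have : (fun x : Bool × Cube d × Cube d => (x.1, mixture x)) ⁻¹' {(true, u)} =
      {true} ×ˢ ({u} ×ˢ Set.univ) := by
    ext ⟨l, v, w⟩
    cases l <;> simp [mixture]
  rw [measureReal_def, obsLaw, Measure.map_apply measurable_label_mixture
    (measurableSet_singleton _), this, population, Measure.prod_prod, Measure.prod_prod,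
    PMF.toMeasure_apply_singleton _ _ (measurableSet_singleton _),
    PMF.toMeasure_apply_singleton _ _ (measurableSet_singleton _), measure_univ, mul_one,
    ENNReal.toReal_mul]

theorem obsLaw_real_false (u : Cube d) :
    P.obsLaw.real {(false, u)} = (P.prior false).toReal * (P.p₂ u).toReal := by
  have : (fun x : Bool × Cube d × Cube d => (x.1, mixture x)) ⁻¹' {(false, u)} =
      {false} ×ˢ (Set.univ ×ˢ {u}) := by
    ext ⟨l, v, w⟩
    cases l <;> simp [mixture]
  rw [measureReal_def, obsLaw, Measure.map_apply measurable_label_mixture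
    (measurableSet_singleton _), this, population, Measure.prod_prod, Measure.prod_prod,
    PMF.toMeasure_apply_singleton _ _ (measurableSet_singleton _),
    PMF.toMeasure_apply_singleton _ _ (measurableSet_singleton _), measure_univ, one_mul,
    ENNReal.toReal_mul]

/-- The expectation of `W`. -/
noncomputable def meanVec (j : Fin d) : ℝ := ∫ x, bit (x.2 j) ∂P.obsLaw

theorem meanVec_mem_Icc (j : Fin d) : P.meanVec j ∈ Set.Icc (0 : ℝ) 1 := by
  refine ⟨integral_nonneg fun x => (bit_mem_Icc _).1, ?_⟩
  have := integral_mono (μ := P.obsLaw) (f := fun x => bit (x.2 j)) (g := fun _ => (1 : ℝ))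
    .of_finite .of_finite fun x => (bit_mem_Icc _).2
  simpa [meanVec] using this

/-- Under the main effects model, the logistic score has mean zero. -/
theorem MainEffects.integral_score_eq_zero {P : DiscreteModel d} {A₀ : ℝ} {A : Fin d → ℝ}
    (h : P.MainEffects A₀ A) (g : Cube d → ℝ) :
    ∫ x, ((if x.1 then 1 else 0) - Real.sigmoid (linPred A₀ A x.2)) * g x.2 ∂P.obsLaw = 0 := by
  rw [integral_fintype .of_finite, Fintype.sum_prod_type, Fintype.sum_bool,
    ← Finset.sum_add_distrib]
  -- The cancellation is cell by cell: the class 1 mass is `e^η` times the class 2 mass, and `e^η (1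
  -- - σ(η)) = σ(η)`. Cells of mass zero cause no trouble.
  refine Finset.sum_eq_zero fun u _ => ?_
  rw [obsLaw_real_true, obsLaw_real_false, h u, Real.sigmoid_def, Real.exp_neg]
  have := Real.exp_pos (linPred A₀ A u)
  simp only [smul_eq_mul, if_true, Bool.false_eq_true, if_false]
  field_simp
  ring

/-- The second moments of the centered features. -/
noncomputable def gram (j k : Option (Fin d)) : ℝ :=
  ∫ x, centeredFeature P.meanVec j x.2 * centeredFeature P.meanVec k x.2 ∂P.obsLaw

theorem meanVec_eq (j : Fin d) : P.meanVec j = ∫ x, bit (mixture x j) ∂P.population :=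
  integral_map measurable_label_mixture.aemeasurable (measurable_of_finite _).aestronglyMeasurable

theorem gram_some_some (i j : Fin d) : P.gram (some i) (some j) = P.covMatrix i j := by
  rw [gram, obsLaw, integral_map measurable_label_mixture.aemeasurable
    (measurable_of_finite _).aestronglyMeasurable, covMatrix, Matrix.of_apply, covariance]
  simp only [centeredFeature, meanVec_eq]

theorem integral_centeredFeature_some (j : Fin d) :
    ∫ x, centeredFeature P.meanVec (some j) x.2 ∂P.obsLaw = 0 := by
  simp only [centeredFeature]
  rw [integral_sub .of_finite .of_finite]
  simp [meanVec]

theorem gram_none_none : P.gram none none = 1 := by simp [gram, centeredFeature]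

theorem gram_none_some (j : Fin d) : P.gram none (some j) = 0 := by
  rw [← P.integral_centeredFeature_some j, gram]
  simp [centeredFeature]

theorem gram_some_none (j : Fin d) : P.gram (some j) none = 0 := by
  rw [← P.integral_centeredFeature_some j, gram]
  simp [centeredFeature]

/-- The population second moment of a linear predictor is bounded below by the intercept and the
coefficients. -/
theorem gram_quadratic_ge {P : DiscreteModel d} {c : ℝ} (hH : P.covMatrix.IsHermitian)
    (hc : ∀ x ∈ spectrum ℝ P.covMatrix, c ≤ x) (β : Option (Fin d) → ℝ) :
    β none ^ 2 + c * ∑ j, β (some j) ^ 2 ≤ ∑ j, ∑ k, β j * β k * P.gram j k := by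
  have := hH.mul_sum_sq_le_of_spectrum hc fun j => β (some j)
  simp only [Fintype.sum_option, gram_none_none, gram_none_some, gram_some_none, gram_some_some,
    mul_zero, Finset.sum_const_zero, add_zero, zero_add]
  linarith

end DiscreteModel

/-! ### Localization of convex minimizers. -/

/-- If a convex function is larger on a sphere than at its centre, its minimum is attained, and only
inside the sphere. -/
theorem ConvexOn.exists_min_and_lt_of_sphere {E : Type*} [NormedAddCommGroup E] [NormedSpace ℝ E]
    {F N : E → ℝ} (hF : ConvexOn ℝ Set.univ F) (hFc : Continuous F)
    (hN : ∀ (t : ℝ) x, 0 ≤ t → N (t • x) = t * N x) {θ₀ : E} {r : ℝ} (hr : 0 < r)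
    (hK : IsCompact {θ | N (θ - θ₀) ≤ r}) (hlt : ∀ x, N x = r → F θ₀ < F (θ₀ + x)) :
    (∃ θ, ∀ θ', F θ ≤ F θ') ∧ ∀ θ, (∀ θ', F θ ≤ F θ') → N (θ - θ₀) < r := by
  have hout : ∀ θ, r ≤ N (θ - θ₀) → F θ₀ < F θ := by
    intro θ hθ
    have hpos : 0 < N (θ - θ₀) := hr.trans_le hθ
    -- Pull `θ` back radially onto the sphere; convexity along the segment carries the strict
    -- inequality outwards.
    set t := r / N (θ - θ₀) with ht
    have ht0 : 0 < t := div_pos hr hpos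
    have ht1 : t ≤ 1 := (div_le_one hpos).2 hθ
    have h1 := hlt (t • (θ - θ₀)) (by rw [hN t _ ht0.le, ht, div_mul_cancel₀ _ hpos.ne'])
    have h2 := hF.2 (Set.mem_univ θ₀) (Set.mem_univ θ) (sub_nonneg.2 ht1) ht0.le (by ring)
    have h3 : (1 - t) • θ₀ + t • θ = θ₀ + t • (θ - θ₀) := by module
    rw [h3, smul_eq_mul, smul_eq_mul] at h2
    nlinarith
  refine ⟨?_, fun θ hθ => ?_⟩
  · have h0 : N (θ₀ - θ₀) ≤ r := by
      have := hN 0 0 le_rfl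
      rw [smul_zero, zero_mul] at this
      rw [sub_self, this]
      exact hr.le
    obtain ⟨θ, -, hθ⟩ := hK.exists_isMinOn ⟨θ₀, h0⟩ hFc.continuousOn
    refine ⟨θ, fun θ' => ?_⟩
    by_cases h : N (θ' - θ₀) ≤ r
    · exact hθ h
    · exact (hθ (a := θ₀) h0).trans (hout θ' (le_of_not_ge h)).le
  · by_contra h
    exact absurd (hθ θ₀) (not_le.2 (hout θ (not_lt.1 h)))

/-! ### Convexity and local growth of the penalized loss. -/

section Loss

variable {n d : ℕ}

/-- The class label as a real number: `1` in class 1 and `0` in class 2. -/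
def response (l : Bool) : ℝ := if l then 1 else 0

theorem penLogisticLoss_eq (lam : ℝ) (s : Fin n → Bool × Cube d) (θ : ℝ × (Fin d → ℝ)) :
    penLogisticLoss lam s θ =
      (∑ i, (softplus (linPred θ.1 θ.2 (s i).2) -
        response (s i).1 * linPred θ.1 θ.2 (s i).2)) / n + lam * ∑ j, |θ.2 j| := by
  rw [penLogisticLoss, Finset.sum_filter, Finset.sum_filter, ← Finset.sum_add_distrib, one_div,
    inv_mul_eq_div]
  congr 2
  refine Finset.sum_congr rfl fun i _ => ?_
  cases (s i).1 <;> simp [softplus, response]; ring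

theorem linPred_add (θ δ : ℝ × (Fin d → ℝ)) (u : Cube d) :
    linPred (θ + δ).1 (θ + δ).2 u = linPred θ.1 θ.2 u + linPred δ.1 δ.2 u := by
  simp only [linPred, Prod.fst_add, Prod.snd_add, Pi.add_apply, add_mul, Finset.sum_add_distrib]
  ring

theorem linPred_smul (t : ℝ) (θ : ℝ × (Fin d → ℝ)) (u : Cube d) :
    linPred (t • θ).1 (t • θ).2 u = t * linPred θ.1 θ.2 u := by
  simp only [linPred, Prod.smul_fst, Prod.smul_snd, Pi.smul_apply, smul_eq_mul, mul_add,
    Finset.mul_sum, mul_assoc]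

theorem continuous_penLogisticLoss (lam : ℝ) (s : Fin n → Bool × Cube d) :
    Continuous (penLogisticLoss lam s) := by
  simp only [funext (penLogisticLoss_eq lam s)]
  have h : ∀ u : Cube d, Continuous fun θ : ℝ × (Fin d → ℝ) => linPred θ.1 θ.2 u := by
    intro u
    unfold linPred
    fun_prop
  refine Continuous.add (Continuous.div_const (continuous_finsetSum _ fun i _ => ?_) _)
    (by fun_prop)
  exact (continuous_softplus.comp (h _)).sub (continuous_const.mul (h _))

theorem convexOn_penLogisticLoss {lam : ℝ} (hlam : 0 ≤ lam) (s : Fin n → Bool × Cube d) :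
    ConvexOn ℝ Set.univ (penLogisticLoss lam s) := by
  refine ⟨convex_univ, fun x _ y _ a b ha hb hab => ?_⟩
  simp only [penLogisticLoss_eq, smul_eq_mul, linPred_add, linPred_smul]
  have h1 : ∑ i, (softplus (a * linPred x.1 x.2 (s i).2 + b * linPred y.1 y.2 (s i).2) -
        response (s i).1 * (a * linPred x.1 x.2 (s i).2 + b * linPred y.1 y.2 (s i).2)) ≤
      a * ∑ i, (softplus (linPred x.1 x.2 (s i).2) -
        response (s i).1 * linPred x.1 x.2 (s i).2) +
      b * ∑ i, (softplus (linPred y.1 y.2 (s i).2) -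
        response (s i).1 * linPred y.1 y.2 (s i).2) := by
    rw [Finset.mul_sum, Finset.mul_sum, ← Finset.sum_add_distrib]
    refine Finset.sum_le_sum fun i _ => ?_
    have := convexOn_softplus.2 (Set.mem_univ (linPred x.1 x.2 (s i).2))
      (Set.mem_univ (linPred y.1 y.2 (s i).2)) ha hb hab
    simp only [smul_eq_mul] at this
    linarith
  have h2 : ∑ j, |(a • x + b • y).2 j| ≤ a * ∑ j, |x.2 j| + b * ∑ j, |y.2 j| := by
    rw [Finset.mul_sum, Finset.mul_sum, ← Finset.sum_add_distrib]
    refine Finset.sum_le_sum fun j _ => (abs_add_le _ _).trans (le_of_eq ?_)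
    simp [abs_mul, abs_of_nonneg ha, abs_of_nonneg hb]
  have h3 := div_le_div_of_nonneg_right h1 (Nat.cast_nonneg (α := ℝ) n)
  have h4 := mul_le_mul_of_nonneg_left h2 hlam
  rw [add_div, mul_div_assoc, mul_div_assoc] at h3
  linarith

theorem centeredCoef_smul (m : Fin d → ℝ) (t : ℝ) (θ : ℝ × (Fin d → ℝ)) (k : Option (Fin d)) :
    centeredCoef m (t • θ) k = t * centeredCoef m θ k := by
  cases k with
  | none =>
    simp only [centeredCoef, Prod.smul_fst, Prod.smul_snd, Pi.smul_apply, smul_eq_mul, mul_add,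
      Finset.mul_sum]
    congr 1
    exact Finset.sum_congr rfl fun j _ => by ring
  | some j => simp [centeredCoef]

/-- Undoing the centering changes the intercept by at most `∑ |θ_j|` because the means lie in `[0,
1]`, so the set sits inside an ordinary ball of the same radius. Compactness yields the existence of
a minimizer. -/
theorem isCompact_sum_abs_centeredCoef_le {m : Fin d → ℝ} (hm : ∀ j, m j ∈ Set.Icc (0 : ℝ) 1)
    (θ₀ : ℝ × (Fin d → ℝ)) (r : ℝ) :
    IsCompact {θ | ∑ k, |centeredCoef m (θ - θ₀) k| ≤ r} := by
  refine (isCompact_closedBall θ₀ r).of_isClosed_subset ?_ fun θ hθ => ?_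
  · refine isClosed_le ?_ continuous_const
    simp only [Fintype.sum_option, centeredCoef, Prod.fst_sub, Prod.snd_sub, Pi.sub_apply]
    fun_prop
  · rw [Metric.mem_closedBall, dist_eq_norm]
    refine le_trans ?_ (show ∑ k, |centeredCoef m (θ - θ₀) k| ≤ r from hθ)
    generalize θ - θ₀ = δ
    refine max_le ?_ ((pi_norm_le_iff_of_nonneg (Finset.sum_nonneg fun _ _ => abs_nonneg _)).2
      fun j => Finset.single_le_sum (f := fun k => |centeredCoef m δ k|)
        (fun _ _ => abs_nonneg _) (Finset.mem_univ (some j)))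
    rw [Fintype.sum_option]
    simp only [centeredCoef, Real.norm_eq_abs]
    have h1 : |∑ j, m j * δ.2 j| ≤ ∑ j, |δ.2 j| := by
      refine (Finset.abs_sum_le_sum_abs _ _).trans (Finset.sum_le_sum fun j _ => ?_)
      rw [abs_mul, abs_of_nonneg (hm j).1]
      exact mul_le_of_le_one_left (abs_nonneg _) (hm j).2
    have h2 := abs_sub (δ.1 + ∑ j, m j * δ.2 j) (∑ j, m j * δ.2 j)
    rw [add_sub_cancel_right] at h2
    linarith

/-- The contribution of one observation to the score at `θ`. -/
noncomputable def scoreTerm (m : Fin d → ℝ) (θ : ℝ × (Fin d → ℝ)) (k : Option (Fin d))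
    (x : Bool × Cube d) : ℝ :=
  (response x.1 - Real.sigmoid (linPred θ.1 θ.2 x.2)) * centeredFeature m k x.2

/-- The contribution of one observation to the empirical second moments of the features. -/
def gramTerm (m : Fin d → ℝ) (p : Option (Fin d) × Option (Fin d)) (x : Bool × Cube d) : ℝ :=
  centeredFeature m p.1 x.2 * centeredFeature m p.2 x.2

theorem abs_scoreTerm_le {m : Fin d → ℝ} (hm : ∀ j, m j ∈ Set.Icc (0 : ℝ) 1)
    (θ : ℝ × (Fin d → ℝ)) (k : Option (Fin d)) (x : Bool × Cube d) : |scoreTerm m θ k x| ≤ 1 := by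
  rw [scoreTerm, abs_mul]
  refine mul_le_one₀ ?_ (abs_nonneg _) (abs_centeredFeature_le hm k x.2)
  have h1 := Real.sigmoid_nonneg (linPred θ.1 θ.2 x.2)
  have h2 := Real.sigmoid_le_one (linPred θ.1 θ.2 x.2)
  rw [abs_le]
  cases x.1 <;> simp only [response, Bool.false_eq_true, if_true, if_false] <;>
    constructor <;> linarith

theorem abs_gramTerm_le {m : Fin d → ℝ} (hm : ∀ j, m j ∈ Set.Icc (0 : ℝ) 1)
    (p : Option (Fin d) × Option (Fin d)) (x : Bool × Cube d) : |gramTerm m p x| ≤ 1 := by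
  rw [gramTerm, abs_mul]
  exact mul_le_one₀ (abs_centeredFeature_le hm _ _) (abs_nonneg _) (abs_centeredFeature_le hm _ _)

theorem sum_centeredCoef_mul_gramTerm (s : Fin n → Bool × Cube d) (m : Fin d → ℝ)
    (δ : ℝ × (Fin d → ℝ)) :
    ∑ j, ∑ k, centeredCoef m δ j * centeredCoef m δ k * ((∑ i, gramTerm m (j, k) (s i)) / n) =
      (∑ i, linPred δ.1 δ.2 (s i).2 ^ 2) / n := by
  have (u : Cube d) : linPred δ.1 δ.2 u ^ 2 = ∑ j, ∑ k, centeredCoef m δ j * centeredCoef m δ k *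
      (centeredFeature m j u * centeredFeature m k u) := by
    rw [linPred_eq_sum_centered m, sq, Finset.sum_mul_sum]
    exact Finset.sum_congr rfl fun j _ => Finset.sum_congr rfl fun k _ => by ring
  simp only [this]
  symm
  rw [Finset.sum_comm, Finset.sum_div]
  refine Finset.sum_congr rfl fun j _ => ?_
  rw [Finset.sum_comm, Finset.sum_div]
  refine Finset.sum_congr rfl fun k _ => ?_
  rw [← Finset.mul_sum, mul_div_assoc]
  rfl

/-- The penalized logistic loss grows quadratically near `θ`, up to the score and the penalty. -/
theorem penLogisticLoss_add_ge (lam : ℝ) (s : Fin n → Bool × Cube d) (m : Fin d → ℝ)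
    {θ δ : ℝ × (Fin d → ℝ)} {R : ℝ} (hθ : ∀ u, |linPred θ.1 θ.2 u| + 1 ≤ R)
    (hδ : ∀ u, |linPred δ.1 δ.2 u| ≤ 1) :
    -∑ k, centeredCoef m δ k * ((∑ i, scoreTerm m θ k (s i)) / n) +
        Real.exp (-R) / 8 * ∑ j, ∑ k, centeredCoef m δ j * centeredCoef m δ k *
          ((∑ i, gramTerm m (j, k) (s i)) / n) +
        lam * (∑ j, |θ.2 j + δ.2 j| - ∑ j, |θ.2 j|) ≤
      penLogisticLoss lam s (θ + δ) - penLogisticLoss lam s θ := by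
  have e1 : ∑ k, centeredCoef m δ k * ((∑ i, scoreTerm m θ k (s i)) / n) =
      (∑ i, (response (s i).1 - Real.sigmoid (linPred θ.1 θ.2 (s i).2)) *
        linPred δ.1 δ.2 (s i).2) / n := by
    simp only [linPred_eq_sum_centered m δ, Finset.sum_div, Finset.mul_sum, scoreTerm]
    rw [Finset.sum_comm]
    exact Finset.sum_congr rfl fun i _ => Finset.sum_congr rfl fun k _ => by ring
  rw [e1, sum_centeredCoef_mul_gramTerm, penLogisticLoss_eq, penLogisticLoss_eq]
  have h : ∑ i, (-((response (s i).1 - Real.sigmoid (linPred θ.1 θ.2 (s i).2)) *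
        linPred δ.1 δ.2 (s i).2) + Real.exp (-R) / 8 * linPred δ.1 δ.2 (s i).2 ^ 2) ≤
      ∑ i, ((softplus (linPred (θ + δ).1 (θ + δ).2 (s i).2) -
        response (s i).1 * linPred (θ + δ).1 (θ + δ).2 (s i).2) -
        (softplus (linPred θ.1 θ.2 (s i).2) - response (s i).1 * linPred θ.1 θ.2 (s i).2)) := by
    refine Finset.sum_le_sum fun i _ => ?_
    rw [linPred_add]
    have h1 := hθ (s i).2
    have h2 := hδ (s i).2
    have := softplus_add_ge (R := R) (x := linPred θ.1 θ.2 (s i).2) (f := linPred δ.1 δ.2 (s i).2)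
      (by linarith) ((abs_add_le _ _).trans (by linarith))
    linarith
  have h3 := div_le_div_of_nonneg_right h (Nat.cast_nonneg (α := ℝ) n)
  rw [Finset.sum_add_distrib, Finset.sum_neg_distrib, Finset.sum_sub_distrib, ← Finset.mul_sum,
    add_div, sub_div, neg_div, mul_div_assoc] at h3
  simp only [Prod.snd_add, Pi.add_apply] at h3 ⊢
  linarith

end Loss

/-! ### The lasso cone, compatibility, and the deterministic error bound. -/

section Deterministic

variable {n d : ℕ}

theorem abs_sum_sum_mul_sub_le {ι : Type*} [Fintype ι] (β : ι → ℝ) {G G' : ι → ι → ℝ} {g : ℝ}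
    (h : ∀ j k, |G' j k - G j k| ≤ g) :
    ∑ j, ∑ k, β j * β k * G j k - g * (∑ k, |β k|) ^ 2 ≤ ∑ j, ∑ k, β j * β k * G' j k := by
  rw [sq, Finset.sum_mul_sum, Finset.mul_sum, ← Finset.sum_sub_distrib]
  refine Finset.sum_le_sum fun j _ => ?_
  rw [Finset.mul_sum, ← Finset.sum_sub_distrib]
  refine Finset.sum_le_sum fun k _ => ?_
  have h1 := mul_le_mul_of_nonneg_left (h j k) (abs_nonneg (β j * β k))
  rw [← abs_mul, abs_mul (β j)] at h1
  have h2 := neg_abs_le (β j * β k * (G' j k - G j k))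
  linarith

/-- The hypothesis gives `|δ_{Sᶜ}|₁ - |δ_S|₁ ≤ (|b| + |δ|₁)/2`, hence `|b| + |δ|₁ ≤ 4 |δ_S|₁ + 2
|b|`; Cauchy–Schwarz on `S` finishes. The number `b` is the unpenalized intercept, so it is carried
separately. -/
theorem sum_abs_sq_le_of_cone {ι : Type*} [Fintype ι] [DecidableEq ι] {A δ : ι → ℝ}
    {S : Finset ι} (hS : ∀ j, j ∉ S → A j = 0) (hS1 : 1 ≤ S.card) {b lam τ : ℝ} (hlam : 0 < lam)
    (hτ : τ ≤ lam / 2)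
    (h : lam * (∑ j, |A j + δ j| - ∑ j, |A j|) ≤ τ * (|b| + ∑ j, |δ j|)) :
    (|b| + ∑ j, |δ j|) ^ 2 ≤ S.card * (32 * ∑ j, δ j ^ 2 + 8 * b ^ 2) := by
  have hsplit (f : ι → ℝ) : ∑ j, f j = ∑ j ∈ S, f j + ∑ j ∈ Sᶜ, f j :=
    (Finset.sum_add_sum_compl S f).symm
  have h1 : ∑ j ∈ Sᶜ, |δ j| - ∑ j ∈ S, |δ j| ≤ ∑ j, |A j + δ j| - ∑ j, |A j| := by
    rw [← Finset.sum_sub_distrib, hsplit fun j => |A j + δ j| - |A j|, sub_eq_neg_add,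
      ← Finset.sum_neg_distrib]
    refine add_le_add (Finset.sum_le_sum fun j _ => ?_) (Finset.sum_le_sum fun j hj => ?_)
    · have := abs_sub (A j + δ j) (δ j)
      rw [add_sub_cancel_right] at this
      linarith
    · rw [hS j (Finset.mem_compl.1 hj)]
      simp
  have hN : 0 ≤ |b| + ∑ j, |δ j| :=
    add_nonneg (abs_nonneg _) (Finset.sum_nonneg fun _ _ => abs_nonneg _)
  have h2 := (mul_le_mul_of_nonneg_left h1 hlam.le).trans
    (h.trans (mul_le_mul_of_nonneg_right hτ hN))
  have h3 : ∑ j ∈ Sᶜ, |δ j| - ∑ j ∈ S, |δ j| ≤ (|b| + ∑ j, |δ j|) / 2 := by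
    refine le_of_mul_le_mul_left ?_ hlam
    linarith
  have hd := hsplit fun j => |δ j|
  have h4 : |b| + ∑ j, |δ j| ≤ 4 * ∑ j ∈ S, |δ j| + 2 * |b| := by linarith
  have h5 : (∑ j ∈ S, |δ j|) ^ 2 ≤ S.card * ∑ j ∈ S, δ j ^ 2 := by
    simpa only [sq_abs] using sq_sum_le_card_mul_sum_sq (s := S) (f := fun j => |δ j|)
  have h6 : ∑ j ∈ S, δ j ^ 2 ≤ ∑ j, δ j ^ 2 :=
    Finset.sum_le_sum_of_subset_of_nonneg (Finset.subset_univ _) fun _ _ _ => sq_nonneg _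
  have h7 : (1 : ℝ) ≤ S.card := by exact_mod_cast hS1
  have h8 : (S.card : ℝ) * ∑ j ∈ S, δ j ^ 2 ≤ S.card * ∑ j, δ j ^ 2 :=
    mul_le_mul_of_nonneg_left h6 (by linarith)
  calc (|b| + ∑ j, |δ j|) ^ 2 ≤ (4 * ∑ j ∈ S, |δ j| + 2 * |b|) ^ 2 := by gcongr
    _ ≤ 32 * (∑ j ∈ S, |δ j|) ^ 2 + 8 * b ^ 2 := by
      rw [← sq_abs b]
      nlinarith [sq_nonneg (4 * ∑ j ∈ S, |δ j| - 2 * |b|)]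
    _ ≤ S.card * (32 * ∑ j, δ j ^ 2 + 8 * b ^ 2) := by
      nlinarith [sq_nonneg b]

/-- The substitute for the cone when the dimension is bounded. -/
theorem sum_abs_sq_le_of_card_le {ι : Type*} [Fintype ι] {δ : ι → ℝ} {b D : ℝ}
    (hD : (Fintype.card ι : ℝ) ≤ D) :
    (|b| + ∑ j, |δ j|) ^ 2 ≤ 2 * D * ∑ j, δ j ^ 2 + 2 * b ^ 2 := by
  have h1 : (∑ j, |δ j|) ^ 2 ≤ Fintype.card ι * ∑ j, δ j ^ 2 := by
    simpa only [sq_abs, Finset.card_univ] using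
      sq_sum_le_card_mul_sum_sq (s := Finset.univ) (f := fun j => |δ j|)
  have h2 : (Fintype.card ι : ℝ) * ∑ j, δ j ^ 2 ≤ D * ∑ j, δ j ^ 2 :=
    mul_le_mul_of_nonneg_right hD (Finset.sum_nonneg fun _ _ => sq_nonneg _)
  rw [← sq_abs b]
  nlinarith [sq_nonneg (|b| - ∑ j, |δ j|)]

/-- Every penalized logistic minimizer is close to `θ`, and there is one, when the score and the
empirical second moments are close to their expectations and the second moments are compatible
with the `ℓ₁` norm on the relevant perturbations. -/
theorem exists_min_and_sum_abs_lt {lam τ g κ r R : ℝ} (hlam : 0 ≤ lam) (s : Fin n → Bool × Cube d)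
    {m : Fin d → ℝ} (hm : ∀ j, m j ∈ Set.Icc (0 : ℝ) 1) {θ : ℝ × (Fin d → ℝ)}
    {G : Option (Fin d) → Option (Fin d) → ℝ}
    (hθ : ∀ u, |linPred θ.1 θ.2 u| + 1 ≤ R)
    (hscore : ∀ k, |(∑ i, scoreTerm m θ k (s i)) / n| ≤ τ)
    (hgram : ∀ j k, |(∑ i, gramTerm m (j, k) (s i)) / n - G j k| ≤ g)
    (hκ : 0 < κ) (hgκ : g * κ ≤ 1 / 2)
    (hcompat : ∀ δ : ℝ × (Fin d → ℝ),
      lam * (∑ j, |θ.2 j + δ.2 j| - ∑ j, |θ.2 j|) ≤ τ * ∑ k, |centeredCoef m δ k| →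
      (∑ k, |centeredCoef m δ k|) ^ 2 ≤
        κ * ∑ j, ∑ k, centeredCoef m δ j * centeredCoef m δ k * G j k)
    (hr : r ≤ 1) (hr' : 16 * κ * Real.exp R * (τ + lam) < r) :
    (∃ θ', IsPenLogisticMin lam s θ') ∧ ∀ θ', IsPenLogisticMin lam s θ' →
      ∑ k, |centeredCoef m (θ' - θ) k| < r := by
  have hτ : 0 ≤ τ := (abs_nonneg _).trans (hscore none)
  have hr0 : 0 < r := lt_of_le_of_lt (by positivity) hr'
  refine (convexOn_penLogisticLoss hlam s).exists_min_and_lt_of_sphere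
    (continuous_penLogisticLoss lam s) (N := fun δ => ∑ k, |centeredCoef m δ k|) ?_ hr0
    (isCompact_sum_abs_centeredCoef_le hm θ r) fun δ hδ => ?_
  · intro t x ht
    simp only [centeredCoef_smul, abs_mul, abs_of_nonneg ht, Finset.mul_sum]
  set N := ∑ k, |centeredCoef m δ k| with hN
  have hδ' : N = r := hδ
  by_contra hcon
  have hlow := penLogisticLoss_add_ge lam s m hθ (δ := δ) fun u =>
    (abs_linPred_le_sum_abs_centeredCoef hm δ u).trans (hδ.trans_le hr)
  have h1 : ∑ k, centeredCoef m δ k * ((∑ i, scoreTerm m θ k (s i)) / n) ≤ τ * N := by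
    rw [hN, Finset.mul_sum]
    refine Finset.sum_le_sum fun k _ => (le_abs_self _).trans ?_
    rw [abs_mul, mul_comm]
    exact mul_le_mul_of_nonneg_right (hscore k) (abs_nonneg _)
  have h2 := abs_sum_sum_mul_sub_le (centeredCoef m δ) hgram
  set Qh := ∑ j, ∑ k, centeredCoef m δ j * centeredCoef m δ k *
    ((∑ i, gramTerm m (j, k) (s i)) / n) with hQh
  set Q := ∑ j, ∑ k, centeredCoef m δ j * centeredCoef m δ k * G j k with hQ
  have hQh0 : 0 ≤ Qh := by
    rw [hQh, sum_centeredCoef_mul_gramTerm]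
    positivity
  have he : 0 < Real.exp (-R) / 8 := by positivity
  -- Dropping the nonnegative curvature term leaves exactly the cone inequality.
  have h3 : lam * (∑ j, |θ.2 j + δ.2 j| - ∑ j, |θ.2 j|) ≤ τ * N := by
    nlinarith [mul_nonneg he.le hQh0]
  have h4 := hcompat δ h3
  have h5 : -∑ j, |δ.2 j| ≤ ∑ j, |θ.2 j + δ.2 j| - ∑ j, |θ.2 j| := by
    rw [← Finset.sum_sub_distrib, ← Finset.sum_neg_distrib]
    refine Finset.sum_le_sum fun j _ => ?_
    have := abs_sub (θ.2 j + δ.2 j) (δ.2 j)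
    rw [add_sub_cancel_right] at this
    linarith
  have h6 : ∑ j, |δ.2 j| ≤ N := by
    rw [hN, Fintype.sum_option]
    simp only [centeredCoef]
    linarith [abs_nonneg (δ.1 + ∑ j, m j * δ.2 j)]
  have h7 : -(lam * N) ≤ lam * (∑ j, |θ.2 j + δ.2 j| - ∑ j, |θ.2 j|) := by
    rw [← mul_neg]
    exact mul_le_mul_of_nonneg_left (by linarith) hlam
  -- Since `g κ ≤ 1/2`, the Gram error takes up at most half of `N²`.
  have h8 : N ^ 2 ≤ 2 * κ * Qh := by
    have a1 := mul_le_mul_of_nonneg_left h2 hκ.le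
    have a2 := mul_le_mul_of_nonneg_right hgκ (sq_nonneg N)
    linarith
  have h9 : Real.exp (-R) / 8 * Qh ≤ (τ + lam) * N := by linarith
  rw [hδ'] at h8 h9
  have h10 : r ^ 2 ≤ 16 * κ * Real.exp R * (τ + lam) * r := by
    have a1 : Qh ≤ 8 * Real.exp R * ((τ + lam) * r) := by
      have := mul_le_mul_of_nonneg_left h9 (show 0 ≤ 8 * Real.exp R by positivity)
      calc Qh = 8 * Real.exp R * (Real.exp (-R) / 8 * Qh) := by
            rw [Real.exp_neg]
            have := Real.exp_pos R
            field_simp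
        _ ≤ _ := this
    have := mul_le_mul_of_nonneg_left a1 hκ.le
    linarith
  nlinarith

end Deterministic

/-! ### Calibration of the tails and the final assembly. -/

/-- A union bound over at most `(d + 1)²` Hoeffding tails at level `T √(log d / n)`. -/
theorem card_mul_exp_le {n d : ℕ} (hn : 0 < n) (hd : 2 ≤ d) {T K : ℝ} (hT : 4 ≤ T)
    (hK : K ≤ ((d : ℝ) + 1) ^ 2) :
    2 * K * Real.exp (-(n * (T * Real.sqrt (Real.log d / n)) ^ 2 / 2)) ≤
      2 * Real.exp (-(T * Real.log d)) := by
  have hd' : (2 : ℝ) ≤ d := by exact_mod_cast hd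
  have hn' : (0 : ℝ) < n := by exact_mod_cast hn
  have hlog : 0 ≤ Real.log d := Real.log_nonneg (by linarith)
  have h1 : ((d : ℝ) + 1) ^ 2 ≤ Real.exp (4 * Real.log d) := by
    rw [mul_comm, Real.exp_mul, Real.exp_log (by linarith),
      show (4 : ℝ) = (4 : ℕ) by norm_num, Real.rpow_natCast]
    have : (d : ℝ) + 1 ≤ d ^ 2 := by nlinarith
    calc ((d : ℝ) + 1) ^ 2 ≤ (d ^ 2) ^ 2 := by gcongr
      _ = (d : ℝ) ^ 4 := by ring
  have h2 : (n : ℝ) * (T * Real.sqrt (Real.log d / n)) ^ 2 / 2 = T ^ 2 / 2 * Real.log d := by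
    rw [mul_pow, Real.sq_sqrt (by positivity)]
    field_simp
  rw [h2, mul_assoc]
  refine mul_le_mul_of_nonneg_left ?_ zero_le_two
  calc K * Real.exp (-(T ^ 2 / 2 * Real.log d))
      ≤ Real.exp (4 * Real.log d) * Real.exp (-(T ^ 2 / 2 * Real.log d)) := by
        gcongr
        exact hK.trans h1
    _ = Real.exp ((4 - T ^ 2 / 2) * Real.log d) := by
        rw [← Real.exp_add]
        ring_nf
    -- `T²/2 - 4 ≥ T` is `(T - 4)(T + 2) ≥ 0`, which is why the threshold is `4`.
    _ ≤ Real.exp (-(T * Real.log d)) := by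
        rw [Real.exp_le_exp, ← neg_mul]
        refine mul_le_mul_of_nonneg_right ?_ hlog
        nlinarith

/-- One compatibility constant serves both regimes: the cone accounts for `32/c + 8`, and bounded
dimension is covered once `2D/c` is added. -/
theorem DiscreteModel.sum_abs_sq_le_gram {d : ℕ} {P : DiscreteModel d} {c : ℝ} (hc0 : 0 < c)
    (hH : P.covMatrix.IsHermitian) (hc : ∀ x ∈ spectrum ℝ P.covMatrix, c ≤ x)
    {A : Fin d → ℝ} (hM : 1 ≤ (coefSupport A).card) {lam τ D : ℝ} (hlam : 0 < lam) (hD : 0 ≤ D)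
    (hτ : τ ≤ lam / 2 ∨ (d : ℝ) ≤ D) (δ : ℝ × (Fin d → ℝ))
    (h : lam * (∑ j, |A j + δ.2 j| - ∑ j, |A j|) ≤ τ * ∑ k, |centeredCoef P.meanVec δ k|) :
    (∑ k, |centeredCoef P.meanVec δ k|) ^ 2 ≤
      (32 / c + 8 + 2 * D / c) * (coefSupport A).card *
        ∑ j, ∑ k, centeredCoef P.meanVec δ j * centeredCoef P.meanVec δ k * P.gram j k := by
  have hQ := gram_quadratic_ge hH hc (centeredCoef P.meanVec δ)
  set Q := ∑ j, ∑ k, centeredCoef P.meanVec δ j * centeredCoef P.meanVec δ k * P.gram j k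
  rw [Fintype.sum_option] at h ⊢
  change _ + c * ∑ j, δ.2 j ^ 2 ≤ _ at hQ
  change _ ≤ τ * (_ + ∑ j, |δ.2 j|) at h
  change (_ + ∑ j, |δ.2 j|) ^ 2 ≤ _
  set b := centeredCoef P.meanVec δ none
  have hM' : (1 : ℝ) ≤ (coefSupport A).card := by exact_mod_cast hM
  set M := ((coefSupport A).card : ℝ)
  have hS0 : 0 ≤ ∑ j, δ.2 j ^ 2 := Finset.sum_nonneg fun _ _ => sq_nonneg _
  have hb : b ^ 2 ≤ Q := by nlinarith
  have hQ0 : 0 ≤ Q := (sq_nonneg b).trans hb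
  have hS : ∑ j, δ.2 j ^ 2 ≤ Q / c := by
    rw [le_div_iff₀ hc0]
    nlinarith [sq_nonneg b]
  have hQc : 0 ≤ Q / c := by positivity
  have hDQ : 0 ≤ D * (Q / c) := by positivity
  have e : (32 / c + 8 + 2 * D / c) * M * Q = M * (32 * (Q / c) + 8 * Q + 2 * (D * (Q / c))) := by
    field_simp
  rw [e]
  rcases hτ with hτ | hd
  · classical
    refine (sum_abs_sq_le_of_cone (S := coefSupport A) (fun j hj => ?_) hM hlam hτ h).trans ?_
    · by_contra h0
      exact hj (by simp [coefSupport, h0])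
    · exact mul_le_mul_of_nonneg_left (by linarith) (by linarith)
  · refine (sum_abs_sq_le_of_card_le (D := D) (by simpa using hd)).trans ?_
    have h1 := mul_le_mul_of_nonneg_left hS hD
    have h2 : 0 ≤ 32 * (Q / c) + 8 * Q + 2 * (D * (Q / c)) := by positivity
    nlinarith [mul_le_mul_of_nonneg_right hM' h2]

theorem two_mul_exp_neg_mul_log_le {ε T : ℝ} (hε : 0 < ε) (hT : 8 / ε ≤ T) {d : ℕ} (hd : 2 ≤ d) :
    2 * Real.exp (-(T * Real.log d)) ≤ ε / 2 := by
  have hd' : (2 : ℝ) ≤ d := by exact_mod_cast hd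
  have hT0 : 0 < T := lt_of_lt_of_le (by positivity) hT
  have hlog : 1 / 2 ≤ Real.log d :=
    (by linarith [Real.log_two_gt_d9] : (1 : ℝ) / 2 ≤ Real.log 2).trans
      (Real.log_le_log two_pos hd')
  have h1 : T / 2 ≤ T * Real.log d := by nlinarith
  have h2 : T / 2 ≤ Real.exp (T * Real.log d) := by
    linarith [Real.add_one_le_exp (T * Real.log d)]
  rw [div_le_iff₀ hε] at hT
  rw [Real.exp_neg, ← div_eq_mul_inv, div_le_iff₀ (Real.exp_pos _)]
  nlinarith

theorem two_mul_exp_neg_four_mul_log_le {ε : ℝ} (hε : 0 < ε) {d : ℕ} (hd : 2 ≤ d)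
    (hdε : 4 / ε ≤ d) : 2 * Real.exp (-(4 * Real.log d)) ≤ ε / 2 := by
  have hd' : (2 : ℝ) ≤ d := by exact_mod_cast hd
  have hlog : 0 ≤ Real.log d := Real.log_nonneg (by linarith)
  have h1 : Real.exp (-(4 * Real.log d)) ≤ Real.exp (-Real.log d) :=
    Real.exp_le_exp.2 (by linarith)
  rw [Real.exp_neg (Real.log d), Real.exp_log (by linarith)] at h1
  have h2 : (d : ℝ)⁻¹ ≤ ε / 4 := by
    rw [inv_le_comm₀ (by linarith) (by positivity), inv_div]
    exact hdε
  linarith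

theorem measurable_scoreTerm {d : ℕ} (m : Fin d → ℝ) (θ : ℝ × (Fin d → ℝ)) (k : Option (Fin d)) :
    Measurable (scoreTerm m θ k) := measurable_of_finite _

theorem measurable_gramTerm {d : ℕ} (m : Fin d → ℝ) (p : Option (Fin d) × Option (Fin d)) :
    Measurable (gramTerm m p) := measurable_of_finite _

theorem mainTheorem3 :
    ∃ C₀ : ℝ, 0 < C₀ ∧
      ∀ (Ω : ℕ → Type*) [∀ n, MeasurableSpace (Ω n)] (μ : ∀ n, Measure (Ω n))
        [∀ n, IsProbabilityMeasure (μ n)]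
        (d : ℕ → ℕ) (P : ∀ n, DiscreteModel (d n))
        (A₀ : ℕ → ℝ) (A : ∀ n, Fin (d n) → ℝ)
        (obs : ∀ n, Fin n → Ω n → Bool × Cube (d n))
        (lam : ℕ → ℝ) (est : ∀ n, Ω n → ℝ × (Fin (d n) → ℝ)) (c B C₁ : ℝ),
        -- the sample of size `n` is i.i.d. from the law of `(L, W)`
        (∀ n, iIndepFun (obs n) (μ n)) →
        (∀ n i, HasLaw (obs n i) (P n).obsLaw (μ n)) →
        -- the log-odds function is linear, and of size at most `M + O(1)`
        (∀ n, (P n).MainEffects (A₀ n) (A n)) →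
        (∀ n u, |linPred (A₀ n) (A n) u| ≤ ((coefSupport (A n)).card : ℝ) + B) →
        -- covariance matrix: positive definite, eigenvalues bounded away from zero
        0 < c →
        (∀ n, (P n).covMatrix.PosDef) →
        (∀ n, ∀ x ∈ spectrum ℝ (P n).covMatrix, c ≤ x) →
        -- irrepresentability and growth
        (∀ n, Irrepresentable (P n).covMatrix (coefSupport (A n))) →
        Tendsto (fun n => etaRate (coefSupport (A n)).card (d n) n) atTop (𝓝 0) →
        (∀ᶠ n in atTop, 2 ≤ d n) →
        (∀ᶠ n in atTop, 1 ≤ (coefSupport (A n)).card) →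
        -- tuning parameter of order `√(log d / n)`, with a large enough constant
        (∀ᶠ n in atTop, C₀ * Real.sqrt (Real.log (d n) / n) ≤ lam n) →
        (∀ᶠ n in atTop, lam n ≤ C₁ * Real.sqrt (Real.log (d n) / n)) →
        -- the estimator is a minimizer of the loss, whenever there is one
        (∀ n ω, (∃ θ, IsPenLogisticMin (lam n) (fun i => obs n i ω) θ) →
          IsPenLogisticMin (lam n) (fun i => obs n i ω) (est n ω)) →
        IsBigOP μ
          (fun n ω => ⨆ u : Cube (d n),
            |linPred (est n ω).1 (est n ω).2 u - linPred (A₀ n) (A n) u|)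
          (fun n => etaRate (coefSupport (A n)).card (d n) n) := by
  -- `8 = 2 · 4`: the score level `4 √(log d / n)` must be at most `λ/2`.
  refine ⟨8, by norm_num, ?_⟩
  intro Ω _ μ _ d P A₀ A obs lam est c B C₁ hind hlaw hmain hbound hc0 hpd hspec _ hrate hd hM
    hlam hlam' hest ε hε
  set D := 4 / ε with hDdef
  set T := max 4 (8 / ε) with hTdef
  have hT4 : 4 ≤ T := le_max_left _ _
  have hD0 : 0 < D := by positivity
  set κ₀ := 32 / c + 8 + 2 * D / c with hκ₀def
  have hκ₀ : 0 < κ₀ := by positivity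
  -- The final `+ 1` makes the radius inequality strict.
  set K := 16 * κ₀ * Real.exp (B + 1) * (T + |C₁|) + 1 with hKdef
  have hK0 : 0 < K := by positivity
  have ev1 : ∀ᶠ n in atTop, T * κ₀ * etaRate (coefSupport (A n)).card (d n) n < 1 / 2 := by
    have := hrate.const_mul (T * κ₀)
    rw [mul_zero] at this
    exact this.eventually_lt_const (by norm_num)
  have ev2 : ∀ᶠ n in atTop, K * etaRate (coefSupport (A n)).card (d n) n < 1 := by
    have := hrate.const_mul K
    rw [mul_zero] at this
    exact this.eventually_lt_const one_pos
  refine ⟨K, ?_⟩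
  filter_upwards [ev1, ev2, hd, hM, hlam, hlam', eventually_gt_atTop 0] with n h1 h2 hd hM hlam
    hlam' hn
  have hn' : (0 : ℝ) < n := by exact_mod_cast hn
  have hd' : (2 : ℝ) ≤ d n := by exact_mod_cast hd
  have hM' : (1 : ℝ) ≤ (coefSupport (A n)).card := by exact_mod_cast hM
  set M := (coefSupport (A n)).card with hMdef
  set ρ := Real.sqrt (Real.log (d n) / n) with hρdef
  have hρ : 0 < ρ := Real.sqrt_pos.2 (div_pos (Real.log_pos (by linarith)) hn')
  have hlam0 : 0 < lam n := lt_of_lt_of_le (by positivity) hlam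
  have heta : etaRate M (d n) n = (M : ℝ) ^ 2 * Real.exp M * ρ := rfl
  have hexpM : 1 ≤ Real.exp (M : ℝ) := Real.one_le_exp (by linarith)
  have hMM : (M : ℝ) * Real.exp M ≤ (M : ℝ) ^ 2 * Real.exp M := by
    have : (M : ℝ) ≤ (M : ℝ) ^ 2 := by nlinarith
    gcongr
  have hMη : (M : ℝ) * ρ ≤ etaRate M (d n) n := by
    rw [heta]
    refine mul_le_mul_of_nonneg_right ?_ hρ.le
    nlinarith
  -- The two regimes: for `d ≥ D` the level `4` has small enough tail and allows the cone; for `d ≤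
  -- D` the larger level `T` is used and the cone is avoided.
  obtain ⟨t, ht4, htT, htprob, htd⟩ : ∃ t, 4 ≤ t ∧ t ≤ T ∧
      2 * Real.exp (-(t * Real.log (d n))) ≤ ε / 2 ∧ (t = 4 ∨ (d n : ℝ) ≤ D) := by
    rcases le_total D (d n) with h | h
    · exact ⟨4, le_rfl, hT4, two_mul_exp_neg_four_mul_log_le hε hd h, Or.inl rfl⟩
    · exact ⟨T, hT4, le_rfl, two_mul_exp_neg_mul_log_le hε (le_max_right _ _) hd, Or.inr h⟩
  set m := (P n).meanVec with hmdef
  have hm := (P n).meanVec_mem_Icc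
  set θ : ℝ × (Fin (d n) → ℝ) := (A₀ n, A n) with hθdef
  have hscore := measure_exists_empirical_dev_le hn (hind n) (hlaw n) (measurable_scoreTerm m θ)
    (abs_scoreTerm_le hm θ) (t := t * ρ) (by positivity)
  -- The Gram level can be `T` in both regimes, since it is not compared with `λ`; it only has to be
  -- small against `1 / (κ₀ M)`.
  have hgram := measure_exists_empirical_dev_le hn (hind n) (hlaw n) (measurable_gramTerm m)
    (abs_gramTerm_le hm) (t := T * ρ) (by positivity)
  have hscore0 (k : Option (Fin (d n))) : ∫ x, scoreTerm m θ k x ∂(P n).obsLaw = 0 :=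
    (hmain n).integral_score_eq_zero (centeredFeature m k)
  simp only [hscore0, sub_zero] at hscore
  have p1 : ((Fintype.card (Option (Fin (d n))) : ℕ) : ℝ) ≤ ((d n : ℝ) + 1) ^ 2 := by
    rw [Fintype.card_option, Fintype.card_fin]
    push_cast
    nlinarith
  have p2 : ((Fintype.card (Option (Fin (d n)) × Option (Fin (d n))) : ℕ) : ℝ) ≤
      ((d n : ℝ) + 1) ^ 2 := by
    rw [Fintype.card_prod, Fintype.card_option, Fintype.card_fin]
    push_cast
    rw [sq]
  replace hscore := hscore.trans (ENNReal.ofReal_le_ofReal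
    ((card_mul_exp_le hn hd ht4 p1).trans htprob))
  replace hgram := hgram.trans (ENNReal.ofReal_le_ofReal
    ((card_mul_exp_le hn hd hT4 p2).trans (two_mul_exp_neg_mul_log_le hε (le_max_right _ _) hd)))
  have hsum := add_le_add hscore hgram
  rw [← ENNReal.ofReal_add (by positivity) (by positivity), add_halves] at hsum
  refine le_trans (measure_mono ?_) ((measure_union_le _ _).trans hsum)
  intro ω hω
  by_contra hgood
  rw [Set.mem_union, not_or] at hgood
  simp only [Set.mem_ofPred_eq, not_exists, not_lt] at hgood hω
  obtain ⟨hs, hg⟩ := hgood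
  have hgκ : T * ρ * (κ₀ * M) ≤ 1 / 2 := by
    have := mul_le_mul_of_nonneg_left hMη (show 0 ≤ T * κ₀ by positivity)
    linarith
  have hτ : t * ρ ≤ lam n / 2 ∨ (d n : ℝ) ≤ D :=
    htd.imp_left fun h => by rw [h]; linarith
  have hθR (u : Cube (d n)) : |linPred θ.1 θ.2 u| + 1 ≤ M + B + 1 := by linarith [hbound n u]
  have hκ : 0 < κ₀ * M := by positivity
  have hmin := exists_min_and_sum_abs_lt hlam0.le (fun i => obs n i ω) hm hθR hs
    (fun j k => hg (j, k)) hκ hgκ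
    (DiscreteModel.sum_abs_sq_le_gram hc0 (hpd n).isHermitian (hspec n) hM hlam0 hD0.le hτ)
    h2.le ?_
  · have hlt := hmin.2 _ (hest n ω hmin.1)
    refine absurd hω (not_lt.2 ?_)
    rw [abs_of_nonneg (Real.iSup_nonneg fun _ => abs_nonneg _)]
    refine ciSup_le fun u => ?_
    have hadd := linPred_add θ (est n ω - θ) u
    rw [add_sub_cancel] at hadd
    rw [show linPred (est n ω).1 (est n ω).2 u - linPred (A₀ n) (A n) u =
      linPred (est n ω - θ).1 (est n ω - θ).2 u by linarith]
    exact (abs_linPred_le_sum_abs_centeredCoef hm _ u).trans hlt.le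
  · have hC : t * ρ + lam n ≤ (T + |C₁|) * ρ := by
      have := mul_le_mul_of_nonneg_right (le_abs_self C₁) hρ.le
      have := mul_le_mul_of_nonneg_right htT hρ.le
      linarith
    have hpos : 0 < (M : ℝ) ^ 2 * Real.exp M * ρ :=
      mul_pos (mul_pos (by positivity) (Real.exp_pos _)) hρ
    calc 16 * (κ₀ * M) * Real.exp (M + B + 1) * (t * ρ + lam n)
        ≤ 16 * (κ₀ * M) * Real.exp (M + B + 1) * ((T + |C₁|) * ρ) := by gcongr
      _ = 16 * κ₀ * Real.exp (B + 1) * (T + |C₁|) * ((M * Real.exp M) * ρ) := by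
          rw [add_assoc (M : ℝ), Real.exp_add]
          ring
      _ ≤ 16 * κ₀ * Real.exp (B + 1) * (T + |C₁|) * ((M : ℝ) ^ 2 * Real.exp M * ρ) :=
          mul_le_mul_of_nonneg_left (mul_le_mul_of_nonneg_right hMM hρ.le) (by positivity)
      _ < K * etaRate M (d n) n := by
          rw [heta, hKdef, add_mul, one_mul]
          linarith
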